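/- **Setting.** Let $n,r,s\ge 1$ be the numbers of voters and candidates and the security parameter, and let $m=2n+1$. Voter $i$ has a private vote $x_i\in\{0,\dots,r-1\}$. Participants use private authenticated channels and a simultaneous broadcast channel, in which all inputs are chosen before any is seen; if a participant refuses to give an input, the protocol aborts. An additive sharing of $v\in\mathbb Z/m$ among a set $S$ gives random shares to all members of $S$ but the last, and to the last one $v$ minus their sum. A *ballot* for candidate $c$ in bin $o\in\{0,\dots,n-1\}$ consists of additive sharings of $rn$ values (one for each of the $n$ bins of each of the $r$ candidates), all $0$ except that of bin $o$ of candidate $c$, which is $1$. A joint random choice from a set with $\ell$ elements is made by adding modulo $\ell$ random numbers that all members of $S$ put into the simultaneous broadcast. *Protocol 1 (basic).* $S$ is the set of voters. In $s$ parallel repetitions, each voter $i$ shares among $S$ a ballot for candidate $x_i$ in a random bin; each member of $S$ adds the shares received, bin by bin, and puts the sums into the simultaneous broadcast. The protocol aborts unless in each repetition the resulting bin values, as residues in $\{0,\dots,2n\}$, are at most $n$ and have sum $n$, and all repetitions give the same total for each candidate; these totals are the result. *Protocol 2 (authorities).* The same, with $S$ a set of $t$ authorities, who finally announce the result. *Protocol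 3 (authorities and verification).* $S$ is a set of $t$ authorities. For each voter $i$ in turn: 1. For each of $s$ sets, the voter picks a random bin $o$, and for each of the $2s$ ballots of the set random shifts $\alpha\in\mathbb Z/r$, $\beta\in\mathbb Z/n$; he shares among $S$ a ballot for candidate $x_i+\alpha$ in bin $o+\beta$. 2. For each set, a joint random choice selects half of the ballots, which are opened through the simultaneous broadcast and discarded; the vote is revoked if one of them is not a valid ballot (for any candidate and bin). The voter broadcasts the shifts of the remaining $s$ ballots (his vote is revoked if he does not), and the authorities undo these shifts on their shares. 3. For each candidate $c$ and each $k\in\mathbb Z/s$, let $X^1,\dots,X^{2s}$ be the shared sums of the bins of candidate $c$ in the remaining ballots of the sets $k$ and $k+1$. In $s$ parallel repetitions, a joint random choice partitions the indices into $P\cup Q$ with $|P|=|Q|=s$, and $Y=\sum_{j\in P}X^j-\sum_{j\in Q}X^j$ is revealed through the simultaneous broadcast. The vote is revoked if some $Y\ne 0$. 4. The authorities broadcast whether the vote is revoked; the protocol aborts if they are not unanimous. Then a joint random choice selects a remaining ballot from each set of each voter, and the result is computed and announced as in Protocol 2 from the selected ballots of the $N$ voters that are not revoked (the bin values having sum $N$).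 **Ideal functionalities.** For Protocols 1 and 2: on input $x_1,\dots,x_n$, return the number of votes of each candidate. For Protocol 3: on input $x_1,\dots,x_n$ and a set $R$ of voters to be revoked, return $R$ and the number of votes of each candidate among the voters outside $R$; the collusion chooses $R$, which may contain honest voters only if some authority is dishonest. **Theorem 3 (privacy of Protocols 1, 2, 3).** Consider any set of dishonest participants (voters in Protocol 1; voters and authorities in Protocols 2 and 3) such that at least one voter (Protocol 1), respectively at least one authority (Protocols 2 and 3), is honest. Whatever the joint strategy of the dishonest participants (computationally unbounded, randomized, adaptive, deviating from the protocol arbitrarily and possibly making it abort), they learn nothing from the execution beyond what follows from their own inputs and the output of the ideal functionality. That is, there is a simulator which is given only the votes of the dishonest voters, makes a single query to the ideal functionality (in Protocol 3 with a set $R$ that it chooses before it receives the output), and whose final output has, for all votes $x_1,\dots,x_n$, exactly the same distribution as the view of the collusion (its randomness, the private messages sent to dishonest participants, and all broadcasts) in the real execution. -/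

import Mathlib

noncomputable section

namespace Voting

/-! ### Protocols executed against a collusion, and perfect privacy

The set of dishonest participants is fixed and is a parameter of each protocol below. A step of a
protocol is one communication round: the honest participants send a message of type `HMsg st` (the
part of their communication that reaches the collusion) and the dishonest participants, at the same
time, send a message of type `AMsg st`. A round in which the collusion may wait for the honest
messages is modelled by two consecutive steps. -/

/-- A protocol whose participants have the joint private input `I`. -/
structure Protocol (I : Type) where
  /-- the random coins of the honest participants, drawn uniformly -/
  Coins : Type
  [fintypeCoins : Fintype Coins]
  [nonemptyCoins : Nonempty Coins]
  Step : Type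
  [decEqStep : DecidableEq Step]
  HMsg : Step → Type
  AMsg : Step → Type
  /-- the order in which the steps are executed -/
  schedule : List Step
  /-- what the honest participants send, given the inputs, their coins and the past -/
  honest : I → Coins → ((st : Step) → Option (HMsg st × AMsg st)) → (st : Step) → HMsg st
  /-- whether the protocol has been aborted -/
  aborted : ((st : Step) → Option (HMsg st × AMsg st)) → Prop

attribute [instance] Protocol.fintypeCoins Protocol.nonemptyCoins Protocol.decEqStep

/-- The messages of the steps that have been executed so far. -/
abbrev Protocol.Transcript {I : Type} (P : Protocol I) : Type :=
  (st : P.Step) → Option (P.HMsg st × P.AMsg st)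

/-- An arbitrary (computationally unbounded, adaptive, randomised) strategy of the collusion, whose
own inputs are of type `K`. The tape holds its randomness and any auxiliary information. -/
structure Adversary {I : Type} (P : Protocol I) (K : Type) where
  Tape : Type
  coins : PMF Tape
  move : Tape → K → P.Transcript → (st : P.Step) → P.AMsg st

open Classical in
/-- Execution of a list of steps, continuing a transcript; it stops as soon as the protocol has
been aborted. -/
def Protocol.run {I : Type} (P : Protocol I) (x : I) (ρ : P.Coins)
    (adv : P.Transcript → (st : P.Step) → P.AMsg st) :
    List P.Step → P.Transcript → P.Transcript
  | [], h => h
  | st :: l, h =>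
      if P.aborted h then h
      else P.run x ρ adv l (Function.update h st (some (P.honest x ρ h st, adv h st)))

/-- The distribution of everything that the collusion sees: its tape and the transcript. -/
def Adversary.view {I K : Type} {P : Protocol I} (A : Adversary P K) (know : I → K) (x : I) :
    PMF (A.Tape × P.Transcript) :=
  A.coins.bind fun τ =>
    (PMF.uniformOfFintype P.Coins).map fun ρ =>
      (τ, P.run x ρ (A.move τ (know x)) P.schedule fun _ => none)

/-- Perfect privacy with respect to an ideal functionality `ideal`. The function `know` extracts
the inputs of the dishonest participants and `Q` is the type of the additional requests that they
may make to the ideal functionality (`Unit` if there are none). For every strategy of the collusion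
there is a simulator which knows the inputs of the collusion, queries the ideal functionality once,
and then produces exactly the distribution of the view of the collusion. -/
def PerfectlyPrivate {I K Q O : Type} (P : Protocol I) (know : I → K) (ideal : I → Q → O) : Prop :=
  ∀ A : Adversary P K, ∃ (σ : Type) (ask : K → PMF (Q × σ))
    (finish : K → σ → O → PMF (A.Tape × P.Transcript)),
    ∀ x : I, A.view know x =
      (ask (know x)).bind fun p => finish (know x) p.2 (ideal x p.1)

/-! ### Secret sharing, ballots, broadcasts -/

/-- One value for each of the `n` bins of each of the `r` candidates, modulo `2 n + 1`. -/
abbrev Bins (n r : ℕ) : Type := Fin r → Fin n → ZMod (2 * n + 1)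

/-- Additive sharing of `v` among `t` participants: all shares but the last are random (`ρ`), and
the last one is `v` minus the sum of the others (the value of `ρ` at the last participant is not
used). -/
def makeADS {t m : ℕ} (v : ZMod m) (ρ : Fin t → ZMod m) (a : Fin t) : ZMod m :=
  if a.val + 1 = t then v - ∑ j : Fin t with j.val + 1 < t, ρ j else ρ a

/-- The secrets of a ballot for candidate `c` in bin `o`. -/
def ballot {n r : ℕ} (c : Fin r) (o : Fin n) : Bins n r :=
  fun c' o' => if c' = c ∧ o' = o then 1 else 0

/-- The secret that results from an exchange of shares over the simultaneous broadcast channel. -/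
def broadcastSum {t : ℕ} {CA : Finset (Fin t)} {α : Type} [AddCommMonoid α]
    (h : {a // a ∉ CA} → α) (d : {a // a ∈ CA} → Option α) : α :=
  ∑ a, h a + ∑ a, (d a).getD 0

/-- The value on which the participants agree by adding random numbers in `{0, …, ℓ - 1}` modulo
`ℓ`, for `ℓ = |T|`, read as an element of the finite set `T`. -/
def randomValue {t : ℕ} {CA : Finset (Fin t)} (T : Type) [Fintype T] [Nonempty T]
    (h : {a // a ∉ CA} → Fin (Fintype.card T))
    (d : {a // a ∈ CA} → Option (Fin (Fintype.card T))) : T :=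
  (Fintype.equivFin T).symm
    ⟨(∑ a, (h a).val + ∑ a, ((d a).map Fin.val).getD 0) % Fintype.card T,
      Nat.mod_lt _ Fintype.card_pos⟩

/-- Sum consistency: no bin is negative, i.e. exceeds `n`, and there are `N` votes in all. -/
def SumConsistent {n r : ℕ} (N : ℕ) (Y : Bins n r) : Prop :=
  (∀ c o, (Y c o).val ≤ n) ∧ ∑ c, ∑ o, (Y c o).val = N

/-- The number of votes of each candidate. -/
def binTotals {n r : ℕ} (Y : Bins n r) : Fin r → ℕ := fun c => ∑ o, (Y c o).val

open Classical in
/-- The result of the `s` parallel tallies of `N` ballots; `none` means abort. -/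
def tallyOutcome {n r s : ℕ} [NeZero s] (N : ℕ) (Y : Fin s → Bins n r) : Option (Fin r → ℕ) :=
  if (∀ k, SumConsistent N (Y k)) ∧ ∀ k k', binTotals (Y k) = binTotals (Y k') then
    some (binTotals (Y 0))
  else none

/-! ### The first two protocols -/

/-- Steps: distribution of the shares (first by the honest voters, then by the dishonest ones, who
may wait for the shares they receive), simultaneous broadcast of the sums, announcement. -/
inductive SumStep
  | deal
  | dealDishonest
  | sums
  | announce

/-- The random choices of the voters: the bin, and the randomness of the sharing, for each
repetition. -/
structure SumCoins (n t r s : ℕ) where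
  bin : Fin n → Fin s → Fin n
  share : Fin n → Fin s → Fin r → Fin n → Fin t → ZMod (2 * n + 1)

set_option synthInstance.maxSize 2000 in
set_option synthInstance.maxHeartbeats 400000 in
instance (n t r s : ℕ) : Fintype (SumCoins n t r s) :=
  have := Finite.of_injective (fun ρ : SumCoins n t r s => (ρ.bin, ρ.share)) fun ρ ρ' h => by
    cases ρ; cases ρ'; simpa using h
  Fintype.ofFinite _

instance (n t r s : ℕ) [NeZero n] : Nonempty (SumCoins n t r s) :=
  ⟨⟨fun _ _ => 0, fun _ _ _ _ _ => 0⟩⟩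

section

variable (n t r s : ℕ) (CV : Finset (Fin n)) (CA : Finset (Fin t))

/-- The honest messages: shares of the honest voters for the dishonest authorities; broadcasts. -/
abbrev SumHMsg : SumStep → Type
  | .deal => {i // i ∉ CV} → {a // a ∈ CA} → Fin s → Bins n r
  | .dealDishonest => Unit
  | .sums => {a // a ∉ CA} → Fin s → Bins n r
  | .announce => {a // a ∉ CA} → Option (Fin r → ℕ)

/-- The dishonest messages; `none` in the simultaneous broadcast is a refusal to participate. -/
abbrev SumAMsg : SumStep → Type
  | .deal => Unit
  | .dealDishonest => {i // i ∈ CV} → {a // a ∉ CA} → Fin s → Bins n r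
  | .sums => {a // a ∈ CA} → Option (Fin s → Bins n r)
  | .announce => {a // a ∈ CA} → Option (Fin r → ℕ)

variable {n t r s CV CA}

/-- The share for participant `a` of the ballot of the honest voter `i` in repetition `k`. -/
def sumBallotShare (x : Fin n → Fin r) (ρ : SumCoins n t r s) (i : Fin n) (a : Fin t)
    (k : Fin s) : Bins n r :=
  fun c o => makeADS (ballot (x i) (ρ.bin i k) c o) (ρ.share i k c o) a

/-- The share received by the honest participant `a` from voter `i`. -/
def sumReceived (x : Fin n → Fin r) (ρ : SumCoins n t r s)
    (h : (st : SumStep) → Option (SumHMsg n t r s CV CA st × SumAMsg n t r s CV CA st))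
    (i : Fin n) (a : {a // a ∉ CA}) (k : Fin s) : Bins n r :=
  if hi : i ∈ CV then
    match h .dealDishonest with
    | some m => m.2 ⟨i, hi⟩ a k
    | none => 0
  else sumBallotShare x ρ i a k

/-- The result that the honest participants compute. -/
def sumOutcome [NeZero s]
    (h : (st : SumStep) → Option (SumHMsg n t r s CV CA st × SumAMsg n t r s CV CA st)) :
    Option (Fin r → ℕ) :=
  match h .sums with
  | some m => tallyOutcome n (broadcastSum m.1 m.2)
  | none => none

/-- The behaviour of the honest participants. -/
def sumHonest [NeZero s] (x : Fin n → Fin r) (ρ : SumCoins n t r s)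
    (h : (st : SumStep) → Option (SumHMsg n t r s CV CA st × SumAMsg n t r s CV CA st)) :
    (st : SumStep) → SumHMsg n t r s CV CA st
  | .deal => fun i a k => sumBallotShare x ρ i a k
  | .dealDishonest => ()
  | .sums => fun a k => ∑ i, sumReceived x ρ h i a k
  | .announce => fun _ => sumOutcome h

end

/-- Voting with authorities: `n` voters, `t` authorities, `r` candidates, `s` repetitions; `CV` and
`CA` are the sets of dishonest voters and authorities. -/
def voteAuthorities (n t r s : ℕ) [NeZero n] [NeZero s] (CV : Finset (Fin n))
    (CA : Finset (Fin t)) : Protocol (Fin n → Fin r) where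
  Coins := SumCoins n t r s
  Step := SumStep
  decEqStep := Classical.decEq _
  HMsg := SumHMsg n t r s CV CA
  AMsg := SumAMsg n t r s CV CA
  schedule := [.deal, .dealDishonest, .sums, .announce]
  honest := sumHonest
  aborted := fun h => ∃ m, h .sums = some m ∧ ∃ a, m.2 a = none

/-- Basic voting: the voters themselves hold the shares and compute the tally, and there is no
final announcement; `C` is the set of dishonest voters. -/
def voteBasic (n r s : ℕ) [NeZero n] [NeZero s] (C : Finset (Fin n)) :
    Protocol (Fin n → Fin r) :=
  { voteAuthorities n n r s C C with schedule := [SumStep.deal, .dealDishonest, .sums] }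

/-! ### The third protocol -/

/-- The subsets with `s` elements. -/
abbrev Subsets (α : Type) (s : ℕ) : Type := {P : Finset α // P.card = s}

instance (s : ℕ) : Nonempty (Subsets (Fin (2 * s)) s) := by
  obtain ⟨P, -, hP⟩ := Finset.exists_subset_card_eq
    (s := (Finset.univ : Finset (Fin (2 * s)))) (n := s) (by simp; omega)
  exact ⟨⟨P, hP⟩⟩

instance (s : ℕ) : Nonempty (Subsets (Fin s ⊕ Fin s) s) := by
  obtain ⟨P, -, hP⟩ := Finset.exists_subset_card_eq
    (s := (Finset.univ : Finset (Fin s ⊕ Fin s))) (n := s) (by simp)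
  exact ⟨⟨P, hP⟩⟩

/-- The elements of `P`, in increasing order. -/
def chosen {s : ℕ} (P : Subsets (Fin (2 * s)) s) (q : Fin s) : Fin (2 * s) :=
  P.1.orderEmbOfFin P.2 q

/-- The elements outside `P`, in increasing order. -/
def unchosen {s : ℕ} (P : Subsets (Fin (2 * s)) s) (q : Fin s) : Fin (2 * s) :=
  P.1ᶜ.orderEmbOfFin (by rw [Finset.card_compl, P.2, Fintype.card_fin]; omega) q

/-- Steps of the third protocol, for voter `i`, set `k` and candidate `c`:
`deal i`: voter `i` distributes the encrypted ballots;
`pickOpen i k`, `opening i k`: choice and opening of half of the ballots of the set;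
`shifts i k`: voter `i` broadcasts the shift values of the remaining ballots;
`pickPart i c k`, `diffs i c k`: equality test for candidate `c` on the sets `k` and `k + 1`;
`verdict i`, `verdictDishonest i`: the authorities broadcast whether voter `i` is revoked (the
dishonest ones may wait for the honest ones);
`pickTally`, `tally`, `announce`: choice of one remaining ballot per set and voter, tally, result. -/
inductive RobustStep (n r s : ℕ)
  | deal (i : Fin n)
  | pickOpen (i : Fin n) (k : Fin s)
  | opening (i : Fin n) (k : Fin s)
  | shifts (i : Fin n) (k : Fin s)
  | pickPart (i : Fin n) (c : Fin r) (k : Fin s)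
  | diffs (i : Fin n) (c : Fin r) (k : Fin s)
  | verdict (i : Fin n)
  | verdictDishonest (i : Fin n)
  | pickTally
  | tally
  | announce

/-- The order of the steps. -/
def robustSchedule (n r s : ℕ) : List (RobustStep n r s) :=
  ((List.finRange n).flatMap fun i =>
    [.deal i]
    ++ ((List.finRange s).flatMap fun k => [.pickOpen i k, .opening i k, .shifts i k])
    ++ ((List.finRange r).flatMap fun c => (List.finRange s).flatMap fun k =>
        [.pickPart i c k, .diffs i c k])
    ++ [.verdict i, .verdictDishonest i])
  ++ [.pickTally, .tally, .announce]

/-- The numbers `{0, …, |T| - 1}` contributed to a joint random choice from `T`. -/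
abbrev Contribution (T : Type) [Fintype T] : Type := Fin (Fintype.card T)

/-- The random choices: for each voter `i` and set `k` the bin, for each of the `2 s` ballots of
the set the candidate shift and the bin shift and the randomness of the sharing; for each authority
its contributions to the joint random choices. -/
structure RobustCoins (n t r s : ℕ) where
  bin : Fin n → Fin s → Fin n
  shift : Fin n → Fin s → Fin (2 * s) → Fin r × Fin n
  share : Fin n → Fin s → Fin (2 * s) → Fin r → Fin n → Fin t → ZMod (2 * n + 1)
  pickOpen : Fin t → Fin n → Fin s → Contribution (Subsets (Fin (2 * s)) s)
  pickPart : Fin t → Fin n → Fin r → Fin s → Fin s → Contribution (Subsets (Fin s ⊕ Fin s) s)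
  pickTally : Fin t → Contribution (Fin n → Fin s → Fin s)

set_option synthInstance.maxSize 2000 in
set_option synthInstance.maxHeartbeats 400000 in
instance (n t r s : ℕ) : Fintype (RobustCoins n t r s) :=
  have := Finite.of_injective
    (fun ρ : RobustCoins n t r s =>
      (ρ.bin, ρ.shift, ρ.share, ρ.pickOpen, ρ.pickPart, ρ.pickTally)) fun ρ ρ' h => by
        cases ρ; cases ρ'; simpa using h
  Fintype.ofFinite _

instance (n t r s : ℕ) [NeZero n] [NeZero r] [NeZero s] : Nonempty (RobustCoins n t r s) :=
  ⟨⟨fun _ _ => 0, fun _ _ _ => (0, 0), fun _ _ _ _ _ _ => 0,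
    fun _ _ _ => ⟨0, Fintype.card_pos⟩, fun _ _ _ _ _ => ⟨0, Fintype.card_pos⟩,
    fun _ => ⟨0, Fintype.card_pos⟩⟩⟩

section

variable (n t r s : ℕ) (CV : Finset (Fin n)) (CA : Finset (Fin t))

/-- The honest messages that reach the collusion. -/
abbrev RobustHMsg : RobustStep n r s → Type
  | .deal i => i ∉ CV → {a // a ∈ CA} → Fin s → Fin (2 * s) → Bins n r
  | .pickOpen _ _ => {a // a ∉ CA} → Contribution (Subsets (Fin (2 * s)) s)
  | .opening _ _ => {a // a ∉ CA} → Fin s → Bins n r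
  | .shifts i _ => i ∉ CV → Fin s → Fin r × Fin n
  | .pickPart _ _ _ => {a // a ∉ CA} → Fin s → Contribution (Subsets (Fin s ⊕ Fin s) s)
  | .diffs _ _ _ => {a // a ∉ CA} → Fin s → ZMod (2 * n + 1)
  | .verdict _ => {a // a ∉ CA} → Bool
  | .verdictDishonest _ => Unit
  | .pickTally => {a // a ∉ CA} → Contribution (Fin n → Fin s → Fin s)
  | .tally => {a // a ∉ CA} → Fin s → Bins n r
  | .announce => {a // a ∉ CA} → Option (Fin r → ℕ)

/-- The dishonest messages; `none` is a refusal to participate in a broadcast. -/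
abbrev RobustAMsg : RobustStep n r s → Type
  | .deal i => i ∈ CV → {a // a ∉ CA} → Fin s → Fin (2 * s) → Bins n r
  | .pickOpen _ _ => {a // a ∈ CA} → Option (Contribution (Subsets (Fin (2 * s)) s))
  | .opening _ _ => {a // a ∈ CA} → Option (Fin s → Bins n r)
  | .shifts i _ => i ∈ CV → Option (Fin s → Fin r × Fin n)
  | .pickPart _ _ _ =>
      {a // a ∈ CA} → Option (Fin s → Contribution (Subsets (Fin s ⊕ Fin s) s))
  | .diffs _ _ _ => {a // a ∈ CA} → Option (Fin s → ZMod (2 * n + 1))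
  | .verdict _ => Unit
  | .verdictDishonest _ => {a // a ∈ CA} → Option Bool
  | .pickTally => {a // a ∈ CA} → Option (Contribution (Fin n → Fin s → Fin s))
  | .tally => {a // a ∈ CA} → Option (Fin s → Bins n r)
  | .announce => {a // a ∈ CA} → Option (Fin r → ℕ)

/-- The messages of the steps executed so far. -/
abbrev RobustTranscript : Type :=
  (st : RobustStep n r s) → Option (RobustHMsg n t r s CV CA st × RobustAMsg n t r s CV CA st)

variable {n t r s CV CA}

/-- The ballots of set `k` of voter `i` that are opened. -/
def openSet (h : RobustTranscript n t r s CV CA) (i : Fin n) (k : Fin s) :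
    Subsets (Fin (2 * s)) s :=
  match h (.pickOpen i k) with
  | some m => randomValue _ m.1 m.2
  | none => Classical.arbitrary _

/-- The block `P` of the partition used in the `l`-th repetition of an equality test. -/
def partSet (h : RobustTranscript n t r s CV CA) (i : Fin n) (c : Fin r) (k l : Fin s) :
    Subsets (Fin s ⊕ Fin s) s :=
  match h (.pickPart i c k) with
  | some m => randomValue _ (fun a => m.1 a l) (fun a => (m.2 a).map fun f => f l)
  | none => Classical.arbitrary _

/-- Which remaining ballot of each set of each voter is taken for the tally. -/
def tallyChoice [NeZero s] (h : RobustTranscript n t r s CV CA) : Fin n → Fin s → Fin s :=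
  match h .pickTally with
  | some m => randomValue _ m.1 m.2
  | none => Classical.arbitrary _

/-- The share for authority `a` of the encrypted ballot `j` in set `k` of the honest voter `i`: the
ballot is for the candidate `x i` and the bin of the set, both shifted. -/
def robustBallotShare [NeZero n] [NeZero r] (x : Fin n → Fin r) (ρ : RobustCoins n t r s)
    (i : Fin n) (a : Fin t) (k : Fin s) (j : Fin (2 * s)) : Bins n r :=
  fun c o => makeADS
    (ballot (x i + (ρ.shift i k j).1) (ρ.bin i k + (ρ.shift i k j).2) c o) (ρ.share i k j c o) a

/-- The share received by the honest authority `a` from voter `i`. -/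
def robustReceived [NeZero n] [NeZero r] (x : Fin n → Fin r) (ρ : RobustCoins n t r s)
    (h : RobustTranscript n t r s CV CA) (i : Fin n) (a : {a // a ∉ CA}) (k : Fin s)
    (j : Fin (2 * s)) : Bins n r :=
  if hi : i ∈ CV then
    match h (.deal i) with
    | some m => m.2 hi a k j
    | none => 0
  else robustBallotShare x ρ i a k j

/-- The shift values broadcast by voter `i` for the `q`-th remaining ballot of set `k`. -/
def robustShift [NeZero n] [NeZero r] (ρ : RobustCoins n t r s)
    (h : RobustTranscript n t r s CV CA) (i : Fin n) (k q : Fin s) : Fin r × Fin n :=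
  if hi : i ∈ CV then
    match h (.shifts i k) with
    | some m => ((m.2 hi).map fun f => f q).getD (0, 0)
    | none => (0, 0)
  else ρ.shift i k (unchosen (openSet h i k) q)

/-- The share of the honest authority `a` of the `q`-th remaining ballot, decrypted. -/
def decrypted [NeZero n] [NeZero r] (x : Fin n → Fin r) (ρ : RobustCoins n t r s)
    (h : RobustTranscript n t r s CV CA) (i : Fin n) (a : {a // a ∉ CA}) (k q : Fin s) :
    Bins n r :=
  fun c o => robustReceived x ρ h i a k (unchosen (openSet h i k) q)
    (c + (robustShift ρ h i k q).1) (o + (robustShift ρ h i k q).2)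

/-- The share of the honest authority `a` of the sum of the bins for candidate `c`, for the
remaining ballots of set `k` (left) and of set `k + 1` modulo `s` (right). -/
def candidateSum [NeZero n] [NeZero r] [NeZero s] (x : Fin n → Fin r) (ρ : RobustCoins n t r s)
    (h : RobustTranscript n t r s CV CA) (i : Fin n) (c : Fin r) (k : Fin s)
    (a : {a // a ∉ CA}) : Fin s ⊕ Fin s → ZMod (2 * n + 1)
  | .inl q => ∑ o, decrypted x ρ h i a k q c o
  | .inr q => ∑ o, decrypted x ρ h i a (k + 1) q c o

/-- The ballot of voter `i` is revoked: an opened ballot is not valid, the shift values are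
missing, or some equality test returns unequal. -/
def Revoked (h : RobustTranscript n t r s CV CA) (i : Fin n) : Prop :=
  (∃ k m, h (.opening i k) = some m ∧
    ∃ q, ¬ ∃ c o, broadcastSum m.1 m.2 q = (ballot c o : Bins n r)) ∨
  (∃ k m, h (.shifts i k) = some m ∧ ∃ hi : i ∈ CV, m.2 hi = none) ∨
  (∃ c k m, h (.diffs i c k) = some m ∧ ∃ l, broadcastSum m.1 m.2 l ≠ 0)

open Classical in
/-- The result that the honest authorities compute. -/
def robustOutcome [NeZero s] (h : RobustTranscript n t r s CV CA) : Option (Fin r → ℕ) :=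
  match h .tally with
  | some m => tallyOutcome (Finset.univ.filter fun i => ¬ Revoked h i).card
      (broadcastSum m.1 m.2)
  | none => none

open Classical in
/-- The behaviour of the honest participants. -/
def robustHonest [NeZero n] [NeZero r] [NeZero s] (x : Fin n → Fin r) (ρ : RobustCoins n t r s)
    (h : RobustTranscript n t r s CV CA) :
    (st : RobustStep n r s) → RobustHMsg n t r s CV CA st
  | .deal i => fun _ a k j => robustBallotShare x ρ i a k j
  | .pickOpen i k => fun a => ρ.pickOpen a i k
  | .opening i k => fun a q => robustReceived x ρ h i a k (chosen (openSet h i k) q)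
  | .shifts i k => fun _ q => ρ.shift i k (unchosen (openSet h i k) q)
  | .pickPart i c k => fun a l => ρ.pickPart a i c k l
  | .diffs i c k => fun a l =>
      ∑ p ∈ (partSet h i c k l).1, candidateSum x ρ h i c k a p
        - ∑ p ∈ (partSet h i c k l).1ᶜ, candidateSum x ρ h i c k a p
  | .verdict i => fun _ => decide (Revoked h i)
  | .verdictDishonest _ => ()
  | .pickTally => fun a => ρ.pickTally a
  | .tally => fun a k =>
      ∑ i with ¬ Revoked h i, decrypted x ρ h i a k (tallyChoice h i k)
  | .announce => fun _ => robustOutcome h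

open Classical in
/-- The messages of a step make the protocol abort: a dishonest authority refuses to participate in
a simultaneous broadcast, or the verdict on a voter is not unanimous. -/
def StepAborts (h : RobustTranscript n t r s CV CA) :
    (st : RobustStep n r s) → RobustAMsg n t r s CV CA st → Prop
  | .pickOpen _ _, m => ∃ a, m a = none
  | .opening _ _, m => ∃ a, m a = none
  | .pickPart _ _ _, m => ∃ a, m a = none
  | .diffs _ _ _, m => ∃ a, m a = none
  | .pickTally, m => ∃ a, m a = none
  | .tally, m => ∃ a, m a = none
  | .verdictDishonest i, m => ∃ a, m a ≠ some (decide (Revoked h i))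
  | .deal _, _ => False
  | .shifts _ _, _ => False
  | .verdict _, _ => False
  | .announce, _ => False

end

/-- Voting with authorities and verification. -/
def voteAuthoritiesRobust (n t r s : ℕ) [NeZero n] [NeZero r] [NeZero s] (CV : Finset (Fin n))
    (CA : Finset (Fin t)) : Protocol (Fin n → Fin r) where
  Coins := RobustCoins n t r s
  Step := RobustStep n r s
  decEqStep := Classical.decEq _
  HMsg := RobustHMsg n t r s CV CA
  AMsg := RobustAMsg n t r s CV CA
  schedule := robustSchedule n r s
  honest := robustHonest
  aborted := fun h => ∃ st m, h st = some m ∧ StepAborts h st m.2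

/-! ### The ideal functionalities -/

/-- The inputs of the dishonest voters. -/
def inputsOf {n r : ℕ} (CV : Finset (Fin n)) (x : Fin n → Fin r) : {i // i ∈ CV} → Fin r :=
  fun i => x i

/-- The ideal functionality of the first two protocols: the number of votes of each candidate. -/
def idealTally {n r : ℕ} (x : Fin n → Fin r) (_ : Unit) : Fin r → ℕ :=
  fun c => (Finset.univ.filter fun i => x i = c).card

/-- The revocations that the collusion may request from the ideal functionality of the third
protocol: a dishonest voter may have his own vote revoked, and a dishonest authority, if there is
one, may have any vote revoked. -/
abbrev Revocation {n t : ℕ} (CV : Finset (Fin n)) (CA : Finset (Fin t)) : Type :=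
  {R : Finset (Fin n) // CA.Nonempty ∨ R ⊆ CV}

/-- The ideal functionality of the third protocol: for each voter, a bit that tells whether his
vote was revoked, and the number of the other votes for each candidate. -/
def idealRobust {n t r : ℕ} {CV : Finset (Fin n)} {CA : Finset (Fin t)} (x : Fin n → Fin r)
    (R : Revocation CV CA) : (Fin n → Bool) × (Fin r → ℕ) :=
  (fun i => decide (i ∈ R.1), fun c => (Finset.univ.filter fun i => i ∉ R.1 ∧ x i = c).card)

end Voting

end

noncomputable section

namespace Voting

/-! ### Conditional distributions and simulators -/

/-! Fix the randomness of the collusion, so that its strategy is deterministic and only the honest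
coins are random. A simulator can sample the request to the ideal functionality by running the
protocol on any inputs compatible with what the collusion knows. After the answer it picks inputs
compatible with that too, and samples a transcript conditioned on the request. By
`perfectlyPrivate_of_law` this is exact if the law of the request depends only on the dishonest
inputs, and the probability of each transcript only on these and the answer.

Probabilities of a transcript `h` are compared by an injection of the coins (`law_apply_le`): coins
producing `h` from the votes `x` go to coins producing `h` from `x'`. Equal totals give a
permutation `π` of the honest voters that turns `x` into `x'`. The bins are permuted along, so the
sum of the honest ballots is unchanged, and one honest share holder `a₀` absorbs the change of each
single ballot. The collusion never sees the shares of `a₀`, and in the broadcast sum the changes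
cancel.

In the third protocol the broadcasts reveal more. An opened ballot must not change at all, so its
secret shifts are altered instead; for the remaining ballots the shifts become public, so these stay
and `a₀` absorbs the change. Which ballots are opened is decided only during the execution, but the
injection may depend on `h` and reads this from `h`; `Reads` records the dependencies that make this
consistent. The equality tests survive because all candidate sums of a voter change by the same
constant, which cancels between blocks of equal size (`candidateSum_recode`,
`sum_sub_sum_compl_add_const`). Only the tally needs `π` to match the votes of the unrevoked honest
voters. Without the tally, any two vote vectors give the same law, so the revocations are
independent of the votes (`robust_map_revocation_eq`). With no dishonest authority, honest voters
are never revoked (`not_revoked_of_honest`), so the request is admissible. -/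

open Classical in
/-- The conditional distribution of `p` given that `f` takes the value `b`; it is `p` itself if this
event has probability zero. -/
def condOn {α β : Type*} (p : PMF α) (f : α → β) (b : β) : PMF α :=
  if h : ∃ a ∈ {a | f a = b}, a ∈ p.support then p.filter {a | f a = b} h else p

/-- The normalising constant is itself a sum over the event, so agreement there suffices. Positive
probability is needed because the fallback values `p` and `q` may differ elsewhere. -/
theorem condOn_congr {α β : Type*} {p q : PMF α} {f : α → β} {b : β}
    (hb : ∃ a ∈ {a | f a = b}, a ∈ p.support) (h : ∀ a, f a = b → p a = q a) :
    condOn p f b = condOn q f b := by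
  have hb' : ∃ a ∈ {a | f a = b}, a ∈ q.support := by
    obtain ⟨a, ha, hp⟩ := hb
    refine ⟨a, ha, ?_⟩
    rwa [PMF.mem_support_iff, ← h a ha]
  have key : Set.indicator {a | f a = b} (p : α → ENNReal) = Set.indicator {a | f a = b} q := by
    ext a
    by_cases ha : f a = b
    · simp [ha, h a ha]
    · simp [ha]
  ext a
  simp only [condOn, hb, hb', dif_pos, PMF.filter_apply, key]

/-- The law of total probability: at `a` only `b = f a` contributes, and the probability of this
value cancels the normalisation. -/
theorem map_bind_condOn {α β : Type*} (p : PMF α) (f : α → β) :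
    (p.map f).bind (condOn p f) = p := by
  classical
  ext a
  have hz : ∀ b, (p.map f) b = ∑' a, Set.indicator {a | f a = b} p a := by
    intro b
    rw [PMF.map_apply]
    refine tsum_congr fun a => ?_
    by_cases h : f a = b
    · simp [h]
    · simp [h, Ne.symm h]
  rw [PMF.bind_apply, tsum_eq_single (f a)]
  · by_cases h : ∃ a' ∈ {a' | f a' = f a}, a' ∈ p.support
    · rw [condOn, dif_pos h, PMF.filter_apply, ← hz, Set.indicator_of_mem (by simp), mul_comm,
        mul_assoc, ENNReal.inv_mul_cancel, mul_one]
      · obtain ⟨a', h1, h2⟩ := h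
        rw [← PMF.mem_support_iff, PMF.mem_support_map_iff]
        exact ⟨a', h2, h1⟩
      · exact PMF.apply_ne_top _ _
    · have ha : p a = 0 := by
        by_contra h'
        exact h ⟨a, rfl, h'⟩
      rw [condOn, dif_neg h, ha, mul_zero]
  · intro b hb
    by_cases h : ∃ a' ∈ {a' | f a' = b}, a' ∈ p.support
    · rw [condOn, dif_pos h, PMF.filter_apply, Set.indicator_of_notMem (by simpa using hb.symm),
        zero_mul, mul_zero]
    · have : (p.map f) b = 0 := by
        by_contra h'
        obtain ⟨a', h1, h2⟩ := (PMF.mem_support_map_iff _ _ _).1 ((PMF.mem_support_iff _ _).2 h')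
        exact h ⟨a', h2, h1⟩
      rw [this, zero_mul]

theorem bind_congr_support {α β : Type*} (p : PMF α) {f g : α → PMF β}
    (h : ∀ a ∈ p.support, f a = g a) : p.bind f = p.bind g := by
  ext b
  rw [PMF.bind_apply, PMF.bind_apply]
  refine tsum_congr fun a => ?_
  by_cases ha : p a = 0
  · simp [ha]
  · rw [h a ((PMF.mem_support_iff _ _).2 ha)]

/-! ### Laws of transcripts, simulators, and comparison of runs -/

namespace Protocol

variable {I : Type} (P : Protocol I)

/-- The distribution of the transcript of the steps `l` against a deterministic strategy. -/
def law (x : I) (adv : P.Transcript → (st : P.Step) → P.AMsg st) (l : List P.Step) :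
    PMF P.Transcript :=
  (PMF.uniformOfFintype P.Coins).map fun ρ => P.run x ρ adv l fun _ => none

/-- A simulator exists as soon as a request `rq` can be read off the transcript in such a way that
its distribution depends on the inputs of the collusion only, and that the probability of a
transcript depends only on these and on the answer to the request. -/
theorem perfectlyPrivate_of_law {K Q O : Type} [Nonempty I] {know : I → K}
    {ideal : I → Q → O} (rq : P.Transcript → Q)
    (hrq : ∀ adv x x', know x = know x' →
      (P.law x adv P.schedule).map rq = (P.law x' adv P.schedule).map rq)
    (hlaw : ∀ adv x x' h, know x = know x' → ideal x (rq h) = ideal x' (rq h) →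
      P.law x adv P.schedule h = P.law x' adv P.schedule h) :
    PerfectlyPrivate P know ideal := by
  classical
  intro A
  -- Inputs compatible with the knowledge of the collusion, and then inputs compatible also with the
  -- answer to a request. They need not agree with each other.
  obtain ⟨rep, hrep⟩ : ∃ rep : K → I, ∀ x, know (rep (know x)) = know x :=
    ⟨Function.invFun know, fun x => Function.invFun_eq ⟨x, rfl⟩⟩
  obtain ⟨rep', hrep'⟩ : ∃ rep' : K → Q → O → I, ∀ x q,
      know (rep' (know x) q (ideal x q)) = know x ∧
      ideal (rep' (know x) q (ideal x q)) q = ideal x q := by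
    refine ⟨fun k q o => Function.invFun (fun x => (know x, ideal x q)) (k, o), fun x q => ?_⟩
    have := Function.invFun_eq (f := fun x => (know x, ideal x q)) (b := (know x, ideal x q))
      ⟨x, rfl⟩
    simpa using this
  -- The state kept between the two phases is the tape and the request: the second phase conditions
  -- on the request already made.
  refine ⟨A.Tape × Q,
    fun k => A.coins.bind fun τ => ((P.law (rep k) (A.move τ k) P.schedule).map rq).map
      fun q => (q, (τ, q)),
    fun k σ o => (condOn (P.law (rep' k σ.2 o) (A.move σ.1 k) P.schedule) rq σ.2).map
      fun h => (σ.1, h), fun x => ?_⟩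
  rw [PMF.bind_bind]
  refine congrArg _ (funext fun τ => ?_)
  rw [PMF.bind_map, hrq _ _ _ (hrep x)]
  -- For a request of positive probability, the true inputs and the substituted ones give the same
  -- conditional law.
  have key : ((P.law x (A.move τ (know x)) P.schedule).map rq).bind (fun q =>
        (condOn (P.law (rep' (know x) q (ideal x q)) (A.move τ (know x)) P.schedule) rq q).map
          fun h => (τ, h)) =
      ((P.law x (A.move τ (know x)) P.schedule).map rq).bind (fun q =>
        (condOn (P.law x (A.move τ (know x)) P.schedule) rq q).map fun h => (τ, h)) := by
    refine bind_congr_support _ fun q hq => ?_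
    obtain ⟨h, hh, hhq⟩ := (PMF.mem_support_map_iff _ _ _).1 hq
    rw [condOn_congr (q := P.law (rep' (know x) q (ideal x q)) (A.move τ (know x)) P.schedule)
      ⟨h, hhq, hh⟩]
    rintro h' rfl
    exact hlaw _ _ _ _ (hrep' x _).1.symm (hrep' x _).2.symm
  change _ = ((P.law x (A.move τ (know x)) P.schedule).map rq).bind (fun q =>
        (condOn (P.law (rep' (know x) q (ideal x q)) (A.move τ (know x)) P.schedule) rq q).map
          fun h => (τ, h))
  rw [key, ← PMF.map_bind, map_bind_condOn, law, PMF.map_comp]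
  rfl

variable {P}

/-- The coins are uniform on a finite set, so an injection is a bijection and reindexes the sum.
Since `h` is fixed, `φ` may depend on it. -/
theorem law_apply_le {x x' : I} {adv : P.Transcript → (st : P.Step) → P.AMsg st}
    {l : List P.Step} {h : P.Transcript} (φ : P.Coins → P.Coins) (hφ : Function.Injective φ)
    (hrun : ∀ ρ, P.run x ρ adv l (fun _ => none) = h → P.run x' (φ ρ) adv l (fun _ => none) = h) :
    P.law x adv l h ≤ P.law x' adv l h := by
  classical
  rw [law, law, PMF.map_apply, PMF.map_apply,
    ← (Equiv.ofBijective φ (Finite.injective_iff_bijective.1 hφ)).tsum_eq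
      fun ρ => if h = P.run x' ρ adv l fun _ => none then _ else _]
  refine ENNReal.tsum_le_tsum fun ρ => ?_
  by_cases hρ : h = P.run x ρ adv l fun _ => none
  · rw [if_pos hρ, Equiv.ofBijective_apply, if_pos (hrun ρ hρ.symm).symm]
    simp
  · rw [if_neg hρ]
    exact zero_le

theorem run_of_aborted {x : I} {ρ : P.Coins} {adv : P.Transcript → (st : P.Step) → P.AMsg st}
    {h : P.Transcript} (hab : P.aborted h) (l : List P.Step) : P.run x ρ adv l h = h := by
  cases l with
  | nil => rfl
  | cons st l => rw [run, if_pos hab]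

theorem run_append (x : I) (ρ : P.Coins) (adv : P.Transcript → (st : P.Step) → P.AMsg st)
    (l l' : List P.Step) (h : P.Transcript) :
    P.run x ρ adv (l ++ l') h = P.run x ρ adv l' (P.run x ρ adv l h) := by
  induction l generalizing h with
  | nil => rfl
  | cons st l ih =>
    by_cases hab : P.aborted h
    · rw [run_of_aborted hab, run_of_aborted hab, run_of_aborted hab]
    · rw [List.cons_append, run, if_neg hab, ih, run, if_neg hab]

theorem run_apply_of_notMem {x : I} {ρ : P.Coins}
    {adv : P.Transcript → (st : P.Step) → P.AMsg st} {l : List P.Step} {st : P.Step}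
    (hst : st ∉ l) (h : P.Transcript) : P.run x ρ adv l h st = h st := by
  induction l generalizing h with
  | nil => rfl
  | cons st' l ih =>
    rw [List.mem_cons, not_or] at hst
    rw [run]
    split_ifs
    · rfl
    · rw [ih hst.2, Function.update_of_ne hst.1]

/-- Honest behaviour is compared only along the run of `x` with `ρ`: by induction from the end, the
other run has reached the same transcript. -/
theorem run_congr {x x' : I} {ρ ρ' : P.Coins}
    {adv : P.Transcript → (st : P.Step) → P.AMsg st} {l : List P.Step} {h : P.Transcript}
    (H : ∀ l₁ st l₂, l = l₁ ++ st :: l₂ →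
      P.honest x' ρ' (P.run x ρ adv l₁ h) st = P.honest x ρ (P.run x ρ adv l₁ h) st) :
    P.run x' ρ' adv l h = P.run x ρ adv l h := by
  induction l using List.reverseRecOn with
  | nil => rfl
  | append_singleton l st ih =>
    rw [run_append, run_append, ih fun l₁ st' l₂ hl => H l₁ st' (l₂ ++ [st]) (by simp [hl]), run,
      run, H l st [] (by simp)]
    rfl

theorem map_law_congr {β : Type*} {f : P.Transcript → β} {x : I}
    {adv : P.Transcript → (st : P.Step) → P.AMsg st} {l l' : List P.Step}
    (h : ∀ ρ, f (P.run x ρ adv l fun _ => none) = f (P.run x ρ adv l' fun _ => none)) :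
    (P.law x adv l).map f = (P.law x adv l').map f := by
  rw [law, law, PMF.map_comp, PMF.map_comp]
  exact congrArg (fun g => PMF.map g _) (funext h)

/-- Every recorded message of the honest participants was computed from the transcript of the
preceding steps. -/
theorem exists_of_run_eq_some {x : I} {ρ : P.Coins}
    {adv : P.Transcript → (st : P.Step) → P.AMsg st} {l : List P.Step} {st : P.Step}
    {m : P.HMsg st × P.AMsg st} (hm : P.run x ρ adv l (fun _ => none) st = some m) :
    ∃ l₁ l₂, l = l₁ ++ st :: l₂ ∧
      m.1 = P.honest x ρ (P.run x ρ adv l₁ fun _ => none) st := by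
  induction l using List.reverseRecOn with
  | nil => simp [run] at hm
  | append_singleton l st' ih =>
    have of_l : P.run x ρ adv l (fun _ => none) st = some m → ∃ l₁ l₂,
        l ++ [st'] = l₁ ++ st :: l₂ ∧
          m.1 = P.honest x ρ (P.run x ρ adv l₁ fun _ => none) st := by
      intro h
      obtain ⟨l₁, l₂, h1, h2⟩ := ih h
      exact ⟨l₁, l₂ ++ [st'], by simp [h1], h2⟩
    rw [run_append, run] at hm
    split_ifs at hm with hab
    · exact of_l hm
    · rw [run] at hm
      by_cases hst : st = st'
      · subst hst
        rw [Function.update_self, Option.some.injEq] at hm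
        exact ⟨l, [], rfl, by rw [← hm]⟩
      · rw [Function.update_of_ne hst] at hm
        exact of_l hm

end Protocol

/-! ### Exchanging the secret of an additive sharing -/

/-- Any single participant can absorb a change of the secret. If it is the last one, its coin is
unused and its share takes up the change by definition; otherwise its coin does, and the two changes
cancel in the last share. -/
theorem makeADS_add_single {t m : ℕ} (v d : ZMod m) (ρ : Fin t → ZMod m) (a₀ a : Fin t) :
    makeADS (v + d) (ρ + Pi.single a₀ d) a = makeADS v ρ a + (Pi.single a₀ d : Fin t → ZMod m) a := by
  have ha := a.isLt
  by_cases h : a.val + 1 = t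
  · rw [makeADS, makeADS, if_pos h, if_pos h]
    simp only [Pi.add_apply, Finset.sum_add_distrib]
    by_cases h0 : a₀ = a
    · subst h0
      rw [Finset.sum_eq_zero (f := fun j => (Pi.single a₀ d : Fin t → ZMod m) j), Pi.single_eq_same]
      · ring
      · intro j hj
        apply Pi.single_eq_of_ne
        rintro rfl
        simp at hj
        omega
    · have h1 : a₀.val + 1 < t := by
        have := a₀.isLt
        have : a₀.val ≠ a.val := fun h => h0 (Fin.ext h)
        omega
      rw [Finset.sum_eq_single_of_mem (f := fun j => (Pi.single a₀ d : Fin t → ZMod m) j) a₀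
        (by simpa using h1) fun j _ hj => Pi.single_eq_of_ne hj _,
        Pi.single_eq_same, Pi.single_eq_of_ne (Ne.symm h0)]
      ring
  · rw [makeADS, makeADS, if_neg h, if_neg h, Pi.add_apply]

theorem sum_makeADS {t m : ℕ} (ht : 0 < t) (v : ZMod m) (ρ : Fin t → ZMod m) :
    ∑ a, makeADS v ρ a = v := by
  obtain ⟨t, rfl⟩ : ∃ t', t = t' + 1 := ⟨t - 1, by omega⟩
  have h1 : ∀ i : Fin t, makeADS v ρ i.castSucc = ρ i.castSucc := fun i => by
    rw [makeADS, if_neg (by simp; omega)]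
  have h2 : ∑ j : Fin (t + 1) with j.val + 1 < t + 1, ρ j = ∑ i : Fin t, ρ i.castSucc := by
    rw [Finset.sum_filter, Fin.sum_univ_castSucc]
    simp
  rw [Fin.sum_univ_castSucc, Finset.sum_congr rfl fun i _ => h1 i, makeADS, if_pos (by simp), h2]
  ring

/-! ### Permuting votes -/

/-- Two vote distributions with the same totals on a set of voters differ there by a permutation. -/
theorem exists_perm_of_card_eq {ι κ : Type*} [Fintype ι] [DecidableEq ι] [DecidableEq κ]
    (p : ι → Prop) [DecidablePred p] (x x' : ι → κ)
    (h : ∀ c, (Finset.univ.filter fun i => p i ∧ x i = c).card =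
      (Finset.univ.filter fun i => p i ∧ x' i = c).card) :
    ∃ π : Equiv.Perm ι, (∀ i, p (π i) ↔ p i) ∧ ∀ i, p i → x' i = x (π i) := by
  have hc : ∀ c, Nonempty ({i : {i // p i} // x' i = c} ≃ {i : {i // p i} // x i = c}) := by
    intro c
    have e : ∀ y : ι → κ, {i : {i // p i} // y i = c} ≃ {i // p i ∧ y i = c} := fun y =>
      Equiv.subtypeSubtypeEquivSubtypeInter p fun i => y i = c
    refine ⟨(e x').trans (Equiv.trans (Fintype.equivOfCardEq ?_) (e x).symm)⟩
    rw [Fintype.card_subtype, Fintype.card_subtype, h]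
  -- Glue bijections from the fibres of `x'` to those of `x`; outside `p` the permutation will be
  -- the identity.
  let e : {i // p i} ≃ {i // p i} :=
    Equiv.ofFiberEquiv (f := fun i : {i // p i} => x' i) (g := fun i : {i // p i} => x i) fun c => (hc c).some
  have he : ∀ i, x (e i) = x' i := fun i =>
    Equiv.ofFiberEquiv_map (f := fun i : {i // p i} => x' i) (g := fun i : {i // p i} => x i) _ i
  refine ⟨Equiv.Perm.ofSubtype e, fun i => ?_, fun i hi => ?_⟩
  · by_cases hi : p i
    · rw [Equiv.Perm.ofSubtype_apply_of_mem e hi]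
      simp [hi, (e ⟨i, hi⟩).2]
    · rw [Equiv.Perm.ofSubtype_apply_of_not_mem e hi]
  · rw [Equiv.Perm.ofSubtype_apply_of_mem e hi, he]

/-- Permuting the voters permutes the honest ballots, so that their sum is unchanged. -/
theorem sum_ballot_perm {n r : ℕ} {p : Fin n → Prop} [DecidablePred p] {x x' : Fin n → Fin r}
    {π : Equiv.Perm (Fin n)} (hp : ∀ i, p (π i) ↔ p i) (hx : ∀ i, p i → x' i = x (π i))
    (b : Fin n → Fin n) (c : Fin r) (o : Fin n) :
    ∑ i with p i, ballot (x' i) (b (π i)) c o = ∑ i with p i, ballot (x i) (b i) c o := by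
  refine Finset.sum_equiv π (fun i => by simp [hp]) fun i hi => ?_
  rw [hx i (by simpa using hi)]

/-! ### The first two protocols -/

section

variable {n t r s : ℕ} {CV : Finset (Fin n)} {CA : Finset (Fin t)}

/-- The coins with which the votes `x'` cause the same messages as the votes `x` with the coins
`ρ`: bins are permuted, and the shares of the participant `a₀` absorb the change of the ballots. -/
def SumCoins.recode (x x' : Fin n → Fin r) (π : Equiv.Perm (Fin n)) (a₀ : Fin t)
    (ρ : SumCoins n t r s) : SumCoins n t r s where
  bin i k := ρ.bin (π i) k
  share i k c o := ρ.share i k c o +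
    Pi.single a₀ (ballot (x' i) (ρ.bin (π i) k) c o - ballot (x i) (ρ.bin i k) c o)

/-- Undo the permutation of the bins first; the correction of the shares depends on the bins only
and can then be subtracted. -/
theorem SumCoins.recode_injective (x x' : Fin n → Fin r) (π : Equiv.Perm (Fin n)) (a₀ : Fin t) :
    Function.Injective (SumCoins.recode (s := s) x x' π a₀) := by
  rintro ⟨b, sh⟩ ⟨b', sh'⟩ h
  simp only [recode, SumCoins.mk.injEq] at h
  obtain ⟨h1, h2⟩ := h
  have hb : b = b' := by
    ext i k : 2
    simpa using congrFun (congrFun h1 (π.symm i)) k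
  subst hb
  congr 1
  ext i k c o : 4
  simpa using congrFun (congrFun (congrFun (congrFun h2 i) k) c) o

theorem sumBallotShare_recode (x x' : Fin n → Fin r) (π : Equiv.Perm (Fin n)) (a₀ a : Fin t)
    (ρ : SumCoins n t r s) (i : Fin n) (k : Fin s) (c : Fin r) (o : Fin n) :
    sumBallotShare x' (ρ.recode x x' π a₀) i a k c o = sumBallotShare x ρ i a k c o +
      (Pi.single a₀ (ballot (x' i) (ρ.bin (π i) k) c o - ballot (x i) (ρ.bin i k) c o) :
        Fin t → ZMod (2 * n + 1)) a := by
  rw [sumBallotShare, sumBallotShare, ← makeADS_add_single, add_sub_cancel]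
  rfl

/-- Shares sent to the collusion are not those of `a₀`. In the broadcast of `a₀` the changes add up
to the difference of two sums of honest ballots, which are permutations of each other. -/
theorem sumHonest_recode [NeZero s] {x x' : Fin n → Fin r} {π : Equiv.Perm (Fin n)} {a₀ : Fin t}
    (ha₀ : a₀ ∉ CA) (hπ : ∀ i, π i ∉ CV ↔ i ∉ CV) (hx : ∀ i, i ∉ CV → x' i = x (π i))
    (ρ : SumCoins n t r s)
    (h : (st : SumStep) → Option (SumHMsg n t r s CV CA st × SumAMsg n t r s CV CA st)) :
    sumHonest x' (ρ.recode x x' π a₀) h = sumHonest x ρ h := by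
  funext st
  cases st with
  | deal =>
    funext i a k c o
    have : (a : Fin t) ≠ a₀ := fun e => ha₀ (e ▸ a.2)
    simp [sumHonest, sumBallotShare_recode, this]
  | dealDishonest => rfl
  | sums =>
    funext a k c o
    simp only [sumHonest, Finset.sum_apply]
    have key : ∀ i, sumReceived x' (ρ.recode x x' π a₀) h i a k c o = sumReceived x ρ h i a k c o +
        if i ∉ CV then (Pi.single a₀ (ballot (x' i) (ρ.bin (π i) k) c o -
          ballot (x i) (ρ.bin i k) c o) : Fin t → ZMod (2 * n + 1)) a else 0 := by
      intro i
      by_cases hi : i ∈ CV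
      · simp [sumReceived, hi]
      · simp [sumReceived, hi, sumBallotShare_recode]
    rw [Finset.sum_congr rfl fun i _ => key i, Finset.sum_add_distrib, ← Finset.sum_filter,
      add_eq_left]
    by_cases ha : (a : Fin t) = a₀
    · simp only [ha, Pi.single_eq_same]
      rw [Finset.sum_sub_distrib, sum_ballot_perm (p := fun i => i ∉ CV) hπ hx
        (fun i => ρ.bin i k), sub_self]
    · simp [ha]
  | announce => rfl

/-- Equal votes of the dishonest voters and equal totals give equal totals of the honest voters. -/
theorem card_honest_eq {x x' : Fin n → Fin r} (hk : inputsOf CV x = inputsOf CV x')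
    (q : Fin n → Prop) [DecidablePred q] (c : Fin r)
    (h : (Finset.univ.filter fun i => q i ∧ x i = c).card =
      (Finset.univ.filter fun i => q i ∧ x' i = c).card) :
    (Finset.univ.filter fun i => (i ∉ CV ∧ q i) ∧ x i = c).card =
      (Finset.univ.filter fun i => (i ∉ CV ∧ q i) ∧ x' i = c).card := by
  have split : ∀ y : Fin n → Fin r, (Finset.univ.filter fun i => q i ∧ y i = c).card =
      (Finset.univ.filter fun i => (i ∉ CV ∧ q i) ∧ y i = c).card +
      (Finset.univ.filter fun i => i ∈ CV ∧ q i ∧ y i = c).card := by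
    intro y
    rw [← Finset.card_filter_add_card_filter_not (fun i => i ∉ CV), Finset.filter_filter,
      Finset.filter_filter]
    congr 2 <;> ext i <;> simp <;> tauto
  have same : (Finset.univ.filter fun i => i ∈ CV ∧ q i ∧ x i = c) =
      Finset.univ.filter fun i => i ∈ CV ∧ q i ∧ x' i = c := by
    ext i
    have : i ∈ CV → x i = x' i := fun hi => congrFun hk ⟨i, hi⟩
    simp only [Finset.mem_filter, Finset.mem_univ, true_and]
    constructor <;> rintro ⟨h1, h2, h3⟩ <;> simp_all
  rw [split x, split x', same] at h
  exact Nat.add_right_cancel h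

theorem voteAuthorities_law_le [NeZero n] [NeZero s] (hCA : ∃ a, a ∉ CA) {x x' : Fin n → Fin r}
    (hk : inputsOf CV x = inputsOf CV x') (ho : idealTally x () = idealTally x' ())
    (adv : (voteAuthorities n t r s CV CA).Transcript →
      (st : SumStep) → SumAMsg n t r s CV CA st) (l : List SumStep)
    (h : (voteAuthorities n t r s CV CA).Transcript) :
    (voteAuthorities n t r s CV CA).law x adv l h ≤
      (voteAuthorities n t r s CV CA).law x' adv l h := by
  obtain ⟨a₀, ha₀⟩ := hCA
  -- The trivial condition stands where the third protocol has "not revoked".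
  obtain ⟨π, hπ, hx⟩ := exists_perm_of_card_eq (fun i => i ∉ CV ∧ True) x x' fun c =>
    card_honest_eq hk (fun _ => True) c (by simpa [idealTally] using congrFun ho c)
  simp only [and_true] at hπ hx
  refine Protocol.law_apply_le (SumCoins.recode x x' π a₀) (SumCoins.recode_injective ..)
    fun ρ hρ => ?_
  rw [← hρ]
  exact Protocol.run_congr fun l₁ st l₂ _ => congrFun (sumHonest_recode ha₀ hπ hx ρ _) st

theorem voteAuthorities_law_eq [NeZero n] [NeZero s] (hCA : ∃ a, a ∉ CA) {x x' : Fin n → Fin r}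
    (hk : inputsOf CV x = inputsOf CV x') (ho : idealTally x () = idealTally x' ())
    (adv : (voteAuthorities n t r s CV CA).Transcript →
      (st : SumStep) → SumAMsg n t r s CV CA st) (l : List SumStep)
    (h : (voteAuthorities n t r s CV CA).Transcript) :
    (voteAuthorities n t r s CV CA).law x adv l h =
      (voteAuthorities n t r s CV CA).law x' adv l h :=
  le_antisymm (voteAuthorities_law_le hCA hk ho adv l h)
    (voteAuthorities_law_le hCA hk.symm ho.symm adv l h)

theorem voteAuthorities_perfectlyPrivate [NeZero n] [NeZero r] [NeZero s] (hCA : ∃ a, a ∉ CA) :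
    PerfectlyPrivate (voteAuthorities n t r s CV CA) (inputsOf CV) idealTally :=
  Protocol.perfectlyPrivate_of_law _ (fun _ => ())
    (fun _ _ _ _ => (PMF.map_const _ _).trans (PMF.map_const _ _).symm)
    fun adv _ _ h hk ho => voteAuthorities_law_eq hCA hk ho adv _ h

/-- A run depends on the list of steps passed to it, not on the schedule stored in the protocol.
Thus basic voting inherits the comparison of laws, which holds for every list of steps. -/
theorem Protocol.run_withSchedule {I : Type} (P : Protocol I) (l₀ : List P.Step) (x : I)
    (ρ : P.Coins) (adv : P.Transcript → (st : P.Step) → P.AMsg st) (l : List P.Step)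
    (h : P.Transcript) :
    ({ P with schedule := l₀ } : Protocol I).run x ρ adv l h = P.run x ρ adv l h := by
  induction l generalizing h with
  | nil => rfl
  | cons st l ih => simp only [Protocol.run, ih]

theorem Protocol.law_withSchedule {I : Type} (P : Protocol I) (l₀ : List P.Step) (x : I)
    (adv : P.Transcript → (st : P.Step) → P.AMsg st) (l : List P.Step) :
    ({ P with schedule := l₀ } : Protocol I).law x adv l = P.law x adv l :=
  congrArg (fun f => PMF.map f (PMF.uniformOfFintype P.Coins))
    (funext fun ρ => P.run_withSchedule l₀ x ρ adv l _)

theorem voteBasic_perfectlyPrivate [NeZero n] [NeZero r] [NeZero s] {C : Finset (Fin n)}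
    (hC : ∃ i, i ∉ C) :
    PerfectlyPrivate (voteBasic n r s C) (inputsOf C) idealTally :=
  Protocol.perfectlyPrivate_of_law _ (fun _ => ())
    (fun _ _ _ _ => (PMF.map_const _ _).trans (PMF.map_const _ _).symm)
    fun adv x x' h hk ho => by
      have e := fun x => Protocol.law_withSchedule (voteAuthorities n n r s C C)
        [SumStep.deal, .dealDishonest, .sums] x adv [SumStep.deal, .dealDishonest, .sums]
      exact (congrArg (fun p => p h) (e x)).trans ((voteAuthorities_law_eq hC hk ho adv _ h).trans
        (congrArg (fun p => p h) (e x')).symm)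

end

/-! ### The third protocol -/

section

variable {n t r s : ℕ} {CV : Finset (Fin n)} {CA : Finset (Fin t)}

theorem chosen_mem (P : Subsets (Fin (2 * s)) s) (q : Fin s) : chosen P q ∈ P.1 :=
  Finset.orderEmbOfFin_mem _ _ _

theorem unchosen_notMem (P : Subsets (Fin (2 * s)) s) (q : Fin s) : unchosen P q ∉ P.1 :=
  Finset.mem_compl.1 (Finset.orderEmbOfFin_mem _ _ _)

theorem ballot_shift (c c' d : Fin r) (o o' e : Fin n) :
    ballot (c + d) (o + e) (c' + d) (o' + e) = ballot c o c' o' := by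
  simp [ballot]

/-- The bin disappears from the sum, so an equality test sees only the candidate. -/
theorem sum_ballot (c c' : Fin r) (o : Fin n) :
    ∑ o', ballot c o c' o' = if c' = c then 1 else 0 := by
  by_cases h : c' = c <;> simp [ballot, h]

/-- Adding a constant to all `X j` changes nothing in a difference of two sums of equal length. -/
theorem sum_sub_sum_compl_add_const {M : Type*} [AddCommGroup M] (P : Subsets (Fin s ⊕ Fin s) s)
    (X : Fin s ⊕ Fin s → M) (d : M) :
    ∑ p ∈ P.1, (X p + d) - ∑ p ∈ P.1ᶜ, (X p + d) = ∑ p ∈ P.1, X p - ∑ p ∈ P.1ᶜ, X p := by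
  have hc : P.1ᶜ.card = s := by
    rw [Finset.card_compl, P.2, Fintype.card_sum, Fintype.card_fin]
    omega
  rw [Finset.sum_add_distrib, Finset.sum_add_distrib, Finset.sum_const, Finset.sum_const, P.2, hc]
  abel

theorem openSet_congr {h h' : RobustTranscript n t r s CV CA} {i : Fin n} {k : Fin s}
    (hh : h (.pickOpen i k) = h' (.pickOpen i k)) : openSet h i k = openSet h' i k := by
  rw [openSet, openSet, hh]

theorem revoked_congr {h h' : RobustTranscript n t r s CV CA}
    (h1 : ∀ i k, h (.opening i k) = h' (.opening i k))
    (h2 : ∀ i k, h (.shifts i k) = h' (.shifts i k))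
    (h3 : ∀ i c k, h (.diffs i c k) = h' (.diffs i c k)) (i : Fin n) :
    Revoked h i ↔ Revoked h' i := by
  simp only [Revoked, h1, h2, h3]

open Classical in
/-- The voters whose votes are revoked according to the transcript. -/
def revokedSet (h : RobustTranscript n t r s CV CA) : Finset (Fin n) :=
  Finset.univ.filter fun i => Revoked h i

open Classical in
/-- The request to the ideal functionality that corresponds to a transcript. -/
def revocation (h : RobustTranscript n t r s CV CA) : Revocation CV CA :=
  -- The default is an arbitrary admissible request. It is reached only if all authorities are
  -- honest and an honest voter is revoked, an event of probability zero.
  if hR : CA.Nonempty ∨ revokedSet h ⊆ CV then ⟨revokedSet h, hR⟩ else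
    ⟨∅, .inr (Finset.empty_subset _)⟩

theorem revocation_congr {h h' : RobustTranscript n t r s CV CA}
    (hh : ∀ i, Revoked h i ↔ Revoked h' i) : revocation h = revocation h' := by
  have : revokedSet h = revokedSet h' := by
    classical
    ext i
    simp [revokedSet, hh]
  simp only [revocation, this]

theorem broadcastSum_of_isEmpty {α : Type} [AddCommMonoid α] (h : {a // a ∉ (∅ : Finset (Fin t))} → α)
    (d : {a // a ∈ (∅ : Finset (Fin t))} → Option α) : broadcastSum h d = ∑ a, h a := by
  simp [broadcastSum]

/-! ### Dependencies between the steps -/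

/-- `Reads st st'`: what the honest participants send in step `st` depends on what happened in the
step `st'` through the choice of the opened ballots or through the revocations. -/
def Reads : RobustStep n r s → RobustStep n r s → Prop
  | .opening i k, st => st = .pickOpen i k
  | .shifts i k, st => st = .pickOpen i k
  | .diffs i _ _, st => ∃ k, st = .pickOpen i k
  | .tally, st => (∃ i k, st = .pickOpen i k) ∨ (∃ i k, st = .opening i k) ∨
      (∃ i k, st = .shifts i k) ∨ ∃ i c k, st = .diffs i c k
  | _, _ => False

theorem not_reads_self (st : RobustStep n r s) : ¬ Reads st st := by
  cases st <;> simp [Reads]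

/-- A step that `st` reads is not executed at `st` or later, so its entry in the transcript is
already final. -/
theorem notMem_of_reads {l₁ l₂ : List (RobustStep n r s)} {st st' : RobustStep n r s}
    (hl : (l₁ ++ st :: l₂).Pairwise fun st st' => ¬ Reads st st') (hst : Reads st st') :
    st' ∉ st :: l₂ := by
  rw [List.pairwise_append, List.pairwise_cons] at hl
  rintro (_ | ⟨_, hmem⟩)
  · exact not_reads_self _ hst
  · exact hl.2.1.1 _ hmem hst

/-- The steps in which the voters are processed. -/
def voterSchedule (n r s : ℕ) : List (RobustStep n r s) :=
  (List.finRange n).flatMap fun i =>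
    [.deal i]
    ++ ((List.finRange s).flatMap fun k => [.pickOpen i k, .opening i k, .shifts i k])
    ++ ((List.finRange r).flatMap fun c => (List.finRange s).flatMap fun k =>
        [.pickPart i c k, .diffs i c k])
    ++ [.verdict i, .verdictDishonest i]

/-- While voters are processed, reads stay within one voter: each choice of ballots precedes their
opening and the shifts, and all choices precede the equality tests. -/
theorem pairwise_not_reads_voterSchedule :
    (voterSchedule n r s).Pairwise fun st st' => ¬ Reads st st' := by
  have hne : ∀ m, (List.finRange m).Pairwise fun a b => ¬ b = a := fun m =>
    (List.nodup_finRange m).imp fun h => Ne.symm h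
  simp [voterSchedule, List.pairwise_append, List.pairwise_flatMap, Reads]
  refine ⟨fun i => ⟨hne s, ⟨⟨fun _ => List.pairwise_of_forall fun _ _ => trivial,
    List.pairwise_of_forall ?_⟩, ?_⟩, ?_⟩, (hne n).imp ?_⟩
  · rintro _ _ _ _ (rfl | rfl) _ _ (rfl | rfl) <;> simp
  · rintro _ _ _ (rfl | rfl) <;> simp
  · rintro _ _ (rfl | rfl | rfl) _ (⟨_, _, rfl | rfl⟩ | rfl | rfl) <;> simp
  · intro i j hij
    rintro _ (⟨_, rfl | rfl | rfl⟩ | ⟨_, _, rfl | rfl⟩ | rfl | rfl) <;>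
      refine ⟨by simp, ?_⟩ <;>
      rintro _ (⟨_, rfl | rfl | rfl⟩ | ⟨_, _, rfl | rfl⟩ | rfl | rfl) <;> simp [hij]

theorem pairwise_not_reads_robustSchedule :
    (robustSchedule n r s).Pairwise fun st st' => ¬ Reads st st' := by
  change (voterSchedule n r s ++ [RobustStep.pickTally, .tally, .announce]).Pairwise _
  rw [List.pairwise_append]
  refine ⟨pairwise_not_reads_voterSchedule, by simp [Reads], ?_⟩
  intro a _ b hb
  simp only [List.mem_cons, List.not_mem_nil, or_false] at hb
  rcases hb with rfl | rfl | rfl <;> cases a <;> simp [Reads]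


/-! ### Recoding the votes -/

variable [NeZero n] [NeZero r]

/-- The change of the encrypted ballots that `RobustCoins.recode` causes: the ballots to be opened,
given by `S`, do not change. -/
def ballotChange (x x' : Fin n → Fin r) (π : Equiv.Perm (Fin n))
    (S : Fin n → Fin s → Subsets (Fin (2 * s)) s) (ρ : RobustCoins n t r s) (i : Fin n) (k : Fin s)
    (j : Fin (2 * s)) : Bins n r :=
  if j ∈ (S i k).1 then 0 else
    ballot (x' i + (ρ.shift i k j).1) (ρ.bin (π i) k + (ρ.shift i k j).2) -
      ballot (x i + (ρ.shift i k j).1) (ρ.bin i k + (ρ.shift i k j).2)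

/-- The coins with which the votes `x'` cause the same messages as the votes `x` with the coins
`ρ`: bins are permuted; for the ballots to be opened, the shifts compensate this; for the other
ballots, the shares of the authority `a₀` do. -/
def RobustCoins.recode (x x' : Fin n → Fin r) (π : Equiv.Perm (Fin n)) (a₀ : Fin t)
    (S : Fin n → Fin s → Subsets (Fin (2 * s)) s) (ρ : RobustCoins n t r s) :
    RobustCoins n t r s where
  bin i k := ρ.bin (π i) k
  shift i k j := ρ.shift i k j +
    if j ∈ (S i k).1 then (x i - x' i, ρ.bin i k - ρ.bin (π i) k) else 0
  share i k j c o := ρ.share i k j c o + Pi.single a₀ (ballotChange x x' π S ρ i k j c o)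
  pickOpen := ρ.pickOpen
  pickPart := ρ.pickPart
  pickTally := ρ.pickTally

/-- The recoding is triangular: bins are recovered first, then the shifts, whose correction involves
only bins, then the shares, whose correction involves bins and shifts. -/
theorem RobustCoins.recode_injective (x x' : Fin n → Fin r) (π : Equiv.Perm (Fin n)) (a₀ : Fin t)
    (S : Fin n → Fin s → Subsets (Fin (2 * s)) s) :
    Function.Injective (RobustCoins.recode x x' π a₀ S) := by
  rintro ⟨b, sft, sh, p1, p2, p3⟩ ⟨b', sft', sh', p1', p2', p3'⟩ h
  simp only [recode, RobustCoins.mk.injEq] at h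
  obtain ⟨h1, h2, h3, rfl, rfl, rfl⟩ := h
  have hb : b = b' := by
    ext i k : 2
    simpa using congrFun (congrFun h1 (π.symm i)) k
  subst hb
  have hsft : sft = sft' := by
    ext i k j : 3
    simpa using congrFun (congrFun (congrFun h2 i) k) j
  subst hsft
  congr 1
  ext i k j c o : 5
  simpa [ballotChange] using congrFun (congrFun (congrFun (congrFun (congrFun h3 i) k) j) c) o

/-- For a ballot to be opened, the new shifts restore the old shifted candidate and bin. For any
other, the shifts are kept and the secret changes by `ballotChange`. -/
theorem robustBallotShare_recode (x x' : Fin n → Fin r) (π : Equiv.Perm (Fin n)) (a₀ a : Fin t)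
    (S : Fin n → Fin s → Subsets (Fin (2 * s)) s) (ρ : RobustCoins n t r s) (i : Fin n)
    (k : Fin s) (j : Fin (2 * s)) (c : Fin r) (o : Fin n) :
    robustBallotShare x' (ρ.recode x x' π a₀ S) i a k j c o = robustBallotShare x ρ i a k j c o +
      (Pi.single a₀ (ballotChange x x' π S ρ i k j c o) : Fin t → ZMod (2 * n + 1)) a := by
  rw [robustBallotShare, robustBallotShare, ← makeADS_add_single]
  refine congrArg (fun v => makeADS v _ a) ?_
  by_cases hj : j ∈ (S i k).1
  · have h1 : x' i + ((ρ.shift i k j).1 + (x i - x' i)) = x i + (ρ.shift i k j).1 := by abel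
    have h2 : ρ.bin (π i) k + ((ρ.shift i k j).2 + (ρ.bin i k - ρ.bin (π i) k)) =
        ρ.bin i k + (ρ.shift i k j).2 := by abel
    simp [RobustCoins.recode, ballotChange, hj, h1, h2]
  · simp [RobustCoins.recode, ballotChange, hj]

theorem robustReceived_recode_of_mem {x x' : Fin n → Fin r} {π : Equiv.Perm (Fin n)} {a₀ : Fin t}
    {S : Fin n → Fin s → Subsets (Fin (2 * s)) s} {ρ : RobustCoins n t r s}
    {h : RobustTranscript n t r s CV CA} {i : Fin n} {a : {a // a ∉ CA}} {k : Fin s}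
    {j : Fin (2 * s)} (hj : j ∈ (S i k).1) :
    robustReceived x' (ρ.recode x x' π a₀ S) h i a k j = robustReceived x ρ h i a k j := by
  by_cases hi : i ∈ CV
  · simp [robustReceived, hi]
  · funext c o
    simp [robustReceived, hi, robustBallotShare_recode, ballotChange, hj]

/-- After the shifts are undone, the change does not depend on `q`: all remaining ballots of a set
carry the same candidate and bin. Hence the choice of the ballot to be tallied is irrelevant. -/
theorem decrypted_recode (x x' : Fin n → Fin r) (π : Equiv.Perm (Fin n)) (a₀ : Fin t)
    {S : Fin n → Fin s → Subsets (Fin (2 * s)) s} (ρ : RobustCoins n t r s)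
    {h : RobustTranscript n t r s CV CA} {i : Fin n} (a : {a // a ∉ CA}) {k : Fin s}
    (hS : openSet h i k = S i k) (q : Fin s) (c : Fin r) (o : Fin n) :
    decrypted x' (ρ.recode x x' π a₀ S) h i a k q c o = decrypted x ρ h i a k q c o +
      if i ∉ CV then (Pi.single a₀ (ballot (x' i) (ρ.bin (π i) k) c o -
        ballot (x i) (ρ.bin i k) c o) : Fin t → ZMod (2 * n + 1)) a else 0 := by
  by_cases hi : i ∈ CV
  · simp [decrypted, robustReceived, robustShift, hi]
  · have hu : unchosen (S i k) q ∉ (S i k).1 := unchosen_notMem _ _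
    have hsh : (ρ.recode x x' π a₀ S).shift i k (unchosen (S i k) q) =
        ρ.shift i k (unchosen (S i k) q) := by
      simp [RobustCoins.recode, hu]
    simp only [decrypted, robustReceived, robustShift, hi, dif_neg, not_false_eq_true, if_true, hS,
      hsh]
    rw [robustBallotShare_recode, ballotChange, if_neg hu, Pi.sub_apply, Pi.sub_apply,
      ballot_shift, ballot_shift]

theorem sum_robustReceived (ht : 0 < t) (x : Fin n → Fin r) (ρ : RobustCoins n t r s)
    (h : RobustTranscript n t r s CV ∅) {i : Fin n} (hi : i ∉ CV) (k : Fin s)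
    (j : Fin (2 * s)) :
    ∑ a, robustReceived x ρ h i a k j =
      ballot (x i + (ρ.shift i k j).1) (ρ.bin i k + (ρ.shift i k j).2) := by
  funext c o
  simp only [Finset.sum_apply, robustReceived, hi, dif_neg, not_false_eq_true, robustBallotShare]
  exact (Fintype.sum_equiv (Equiv.subtypeUnivEquiv (p := fun a => a ∉ (∅ : Finset (Fin t)))
    (by simp)) _ (fun a => makeADS (ballot (x i + (ρ.shift i k j).1)
      (ρ.bin i k + (ρ.shift i k j).2) c o) (ρ.share i k j c o) a) fun a => rfl).trans
    (sum_makeADS ht _ _)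

variable [NeZero s]

/-- Summing over the bins removes the bin, so the change is one constant for all `p`, even though
two sets with different bins are involved. -/
theorem candidateSum_recode (x x' : Fin n → Fin r) (π : Equiv.Perm (Fin n)) (a₀ : Fin t)
    {S : Fin n → Fin s → Subsets (Fin (2 * s)) s} (ρ : RobustCoins n t r s)
    {h : RobustTranscript n t r s CV CA} {i : Fin n} (a : {a // a ∉ CA})
    (hS : ∀ k, openSet h i k = S i k) (c : Fin r) (k : Fin s) (p : Fin s ⊕ Fin s) :
    candidateSum x' (ρ.recode x x' π a₀ S) h i c k a p = candidateSum x ρ h i c k a p +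
      if i ∉ CV then (Pi.single a₀ ((if c = x' i then 1 else 0) - if c = x i then 1 else 0) :
        Fin t → ZMod (2 * n + 1)) a else 0 := by
  have key : ∀ k q, ∑ o, decrypted x' (ρ.recode x x' π a₀ S) h i a k q c o =
      ∑ o, decrypted x ρ h i a k q c o +
      if i ∉ CV then (Pi.single a₀ ((if c = x' i then 1 else 0) - if c = x i then 1 else 0) :
        Fin t → ZMod (2 * n + 1)) a else 0 := by
    intro k q
    rw [Finset.sum_congr rfl fun o _ => decrypted_recode x x' π a₀ ρ a (hS k) q c o,
      Finset.sum_add_distrib]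
    congr 1
    by_cases hi : i ∈ CV
    · simp [hi]
    · by_cases ha : (a : Fin t) = a₀
      · simp only [hi, not_false_eq_true, if_true, ha, Pi.single_eq_same, Finset.sum_sub_distrib,
          sum_ballot]
      · simp [ha]
  cases p with
  | inl q => exact key k q
  | inr q => exact key (k + 1) q

/-- Here `h₁` is the complete transcript that determines the recoding, and `h` the part known when
`st` is executed. They have to agree only on what `st` reads, and the permutation has to fit the
votes only for the tally. -/
theorem robustHonest_recode {x x' : Fin n → Fin r} {π : Equiv.Perm (Fin n)} {a₀ : Fin t}
    (ha₀ : a₀ ∉ CA) {h₁ : RobustTranscript n t r s CV CA} (ρ : RobustCoins n t r s)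
    (h : RobustTranscript n t r s CV CA) {st : RobustStep n r s}
    (hh : ∀ st', Reads st st' → h st' = h₁ st')
    (hst : st = .tally → (∀ i, (π i ∉ CV ∧ ¬ Revoked h₁ (π i)) ↔ (i ∉ CV ∧ ¬ Revoked h₁ i)) ∧
      ∀ i, i ∉ CV ∧ ¬ Revoked h₁ i → x' i = x (π i)) :
    robustHonest x' (ρ.recode x x' π a₀ (openSet h₁)) h st = robustHonest x ρ h st := by
  classical
  cases st with
  | deal i =>
    funext hi a k j c o
    have : (a : Fin t) ≠ a₀ := fun e => ha₀ (e ▸ a.2)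
    simp [robustHonest, robustBallotShare_recode, this]
  | pickOpen i k => rfl
  | opening i k =>
    funext a q
    refine robustReceived_recode_of_mem ?_
    rw [← openSet_congr (hh (.pickOpen i k) rfl)]
    exact chosen_mem _ _
  | shifts i k =>
    funext hi q
    have hu : unchosen (openSet h i k) q ∉ (openSet h₁ i k).1 := by
      rw [← openSet_congr (hh (.pickOpen i k) rfl)]
      exact unchosen_notMem _ _
    simp [robustHonest, RobustCoins.recode, hu]
  | pickPart i c k => rfl
  | diffs i c k =>
    funext a l
    have hS : ∀ k, openSet h i k = openSet h₁ i k := fun k =>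
      openSet_congr (hh (.pickOpen i k) ⟨k, rfl⟩)
    simp only [robustHonest, candidateSum_recode x x' π a₀ ρ a hS]
    -- The two blocks of the partition have equal size, so the common change cancels.
    exact sum_sub_sum_compl_add_const _ _ _
  | verdict i => rfl
  | verdictDishonest i => rfl
  | pickTally => rfl
  | tally =>
    obtain ⟨hπ, hx⟩ := hst rfl
    have hS : ∀ i k, openSet h i k = openSet h₁ i k := fun i k =>
      openSet_congr (hh (.pickOpen i k) (.inl ⟨i, k, rfl⟩))
    have hR : ∀ i, Revoked h i ↔ Revoked h₁ i := revoked_congr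
      (fun i k => hh _ (.inr (.inl ⟨i, k, rfl⟩)))
      (fun i k => hh _ (.inr (.inr (.inl ⟨i, k, rfl⟩))))
      (fun i c k => hh _ (.inr (.inr (.inr ⟨i, c, k, rfl⟩))))
    funext a k c o
    simp only [robustHonest, Finset.sum_apply]
    rw [Finset.sum_congr rfl fun i _ => decrypted_recode x x' π a₀ ρ a (hS i k) _ c o,
      Finset.sum_add_distrib, ← Finset.sum_filter, Finset.filter_filter, add_eq_left]
    by_cases ha : (a : Fin t) = a₀
    · simp only [ha, Pi.single_eq_same, Finset.sum_sub_distrib]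
      have e : ∀ i, (¬ Revoked h i ∧ i ∉ CV) ↔ (i ∉ CV ∧ ¬ Revoked h₁ i) := fun i => by
        rw [hR, and_comm]
      simp only [e]
      -- Only unrevoked honest ballots changed, and `π` permutes exactly these.
      rw [sum_ballot_perm (p := fun i => i ∉ CV ∧ ¬ Revoked h₁ i) hπ hx
        (fun i => ρ.bin i k), sub_self]
    · simp [ha]
  | announce => rfl

/-! ### Comparison of transcript probabilities in the third protocol -/

variable (n t r s CV CA) in
/-- A deterministic strategy of the collusion. -/
abbrev RobustStrategy : Type :=
  (voteAuthoritiesRobust n t r s CV CA).Transcript →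
    (st : (voteAuthoritiesRobust n t r s CV CA).Step) →
      (voteAuthoritiesRobust n t r s CV CA).AMsg st

theorem robust_law_le {a₀ : Fin t} (ha₀ : a₀ ∉ CA) {x x' : Fin n → Fin r}
    (adv : RobustStrategy n t r s CV CA) {l : List (RobustStep n r s)}
    (hl : l.Pairwise fun st st' => ¬ Reads st st') {h : RobustTranscript n t r s CV CA}
    {π : Equiv.Perm (Fin n)}
    (hπ : .tally ∈ l → (∀ i, (π i ∉ CV ∧ ¬ Revoked h (π i)) ↔ (i ∉ CV ∧ ¬ Revoked h i)) ∧
      ∀ i, i ∉ CV ∧ ¬ Revoked h i → x' i = x (π i)) :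
    (voteAuthoritiesRobust n t r s CV CA).law x adv l h ≤
      (voteAuthoritiesRobust n t r s CV CA).law x' adv l h := by
  refine Protocol.law_apply_le (RobustCoins.recode x x' π a₀ (openSet h))
    (RobustCoins.recode_injective ..) fun ρ hρ => ?_
  rw [← hρ]
  refine Protocol.run_congr fun l₁ st l₂ hsplit => ?_
  rw [hρ]
  refine robustHonest_recode ha₀ ρ _ (fun st' hst' => ?_) fun hst => hπ ?_
  rotate_left
  · rw [hsplit]
    exact List.mem_append_right _ (hst ▸ List.mem_cons_self)
  -- The entries that `st` reads are not touched by the rest of the run, so they already have their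
  -- values in `h`.
  · subst hsplit
    rw [Protocol.run_append] at hρ
    rw [← hρ]
    refine (Protocol.run_apply_of_notMem (P := voteAuthoritiesRobust n t r s CV CA) (st := st')
      (notMem_of_reads hl hst') _).symm

/-! ### Honest voters are revoked only by dishonest authorities -/

/-- All shares are held by honest authorities here, and they reconstruct the decrypted ballot of an
honest voter, the same vote for every `p`. -/
theorem sum_candidateSum (ht : 0 < t) (x : Fin n → Fin r) (ρ : RobustCoins n t r s)
    (h : RobustTranscript n t r s CV ∅) {i : Fin n} (hi : i ∉ CV) (c : Fin r) (k : Fin s)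
    (p : Fin s ⊕ Fin s) :
    ∑ a, candidateSum x ρ h i c k a p = if c = x i then 1 else 0 := by
  have key : ∀ k q, ∑ a, ∑ o, decrypted x ρ h i a k q c o = if c = x i then 1 else 0 := by
    intro k q
    rw [Finset.sum_comm, ← sum_ballot (x i) c (ρ.bin i k)]
    refine Finset.sum_congr rfl fun o _ => ?_
    have := congrFun (congrFun (sum_robustReceived ht x ρ h hi k (unchosen (openSet h i k) q))
      (c + (robustShift ρ h i k q).1)) (o + (robustShift ρ h i k q).2)
    simp only [Finset.sum_apply] at this
    simp only [decrypted, this]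
    simp only [robustShift, hi, dif_neg, not_false_eq_true, ballot_shift]
  cases p with
  | inl q => exact key k q
  | inr q => exact key (k + 1) q

theorem sum_diffs (ht : 0 < t) (x : Fin n → Fin r) (ρ : RobustCoins n t r s)
    (h : RobustTranscript n t r s CV ∅) {i : Fin n} (hi : i ∉ CV) (c : Fin r) (k : Fin s)
    (P : Subsets (Fin s ⊕ Fin s) s) :
    ∑ a, (∑ p ∈ P.1, candidateSum x ρ h i c k a p - ∑ p ∈ P.1ᶜ, candidateSum x ρ h i c k a p) =
      0 := by
  rw [Finset.sum_sub_distrib, Finset.sum_comm, Finset.sum_comm (s := Finset.univ)]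
  simp only [sum_candidateSum ht x ρ h hi]
  simpa using sum_sub_sum_compl_add_const P 0 (if c = x i then (1 : ZMod (2 * n + 1)) else 0)

/-- Without dishonest authorities a broadcast reveals the true secret: an opened honest ballot is
valid and a difference in an equality test is zero. Missing shifts count only against dishonest
voters. -/
theorem not_revoked_of_honest (ht : 0 < t) {x : Fin n → Fin r} {ρ : RobustCoins n t r s}
    {adv : RobustStrategy n t r s CV ∅} {l : List (RobustStep n r s)}
    {i : Fin n} (hi : i ∉ CV) :
    ¬ Revoked ((voteAuthoritiesRobust n t r s CV ∅).run x ρ adv l fun _ => none) i := by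
  rintro (⟨k, m, hm, q, hq⟩ | ⟨k, m, hm, hi', -⟩ | ⟨c, k, m, hm, j, hj⟩)
  · obtain ⟨l₁, l₂, -, h1⟩ := Protocol.exists_of_run_eq_some hm
    rw [broadcastSum_of_isEmpty, h1] at hq
    exact hq ⟨_, _, (Finset.sum_apply q _ _).trans (sum_robustReceived ht x ρ _ hi k _)⟩
  · exact hi hi'
  · obtain ⟨l₁, l₂, -, h1⟩ := Protocol.exists_of_run_eq_some hm
    rw [broadcastSum_of_isEmpty, h1] at hj
    exact hj ((Finset.sum_apply j _ _).trans (sum_diffs ht x ρ _ hi c k _))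

/-! ### Privacy of the third protocol -/

theorem robust_map_revocation_eq {a₀ : Fin t} (ha₀ : a₀ ∉ CA) {x x' : Fin n → Fin r}
    (adv : RobustStrategy n t r s CV CA) :
    ((voteAuthoritiesRobust n t r s CV CA).law x adv (robustSchedule n r s)).map revocation =
      ((voteAuthoritiesRobust n t r s CV CA).law x' adv (robustSchedule n r s)).map
        revocation := by
  -- The revocations are settled before the tally, so the last three steps can be cut off.
  have trunc : ∀ y, ((voteAuthoritiesRobust n t r s CV CA).law y adv
      (robustSchedule n r s)).map revocation =
      ((voteAuthoritiesRobust n t r s CV CA).law y adv (voterSchedule n r s)).map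
        revocation := by
    intro y
    refine Protocol.map_law_congr fun ρ => ?_
    have mem : ∀ st : RobustStep n r s, st ∈ [RobustStep.pickTally, .tally, .announce] →
        st = .pickTally ∨ st = .tally ∨ st = .announce := by simp
    refine (congrArg revocation (Protocol.run_append y ρ adv (voterSchedule n r s)
      [RobustStep.pickTally, .tally, .announce] _)).trans ?_
    refine revocation_congr (revoked_congr (fun i k => ?_) (fun i k => ?_) fun i c k => ?_) <;>
      exact Protocol.run_apply_of_notMem (fun hst => by simpa using mem _ hst) _
  have htally : RobustStep.tally ∉ voterSchedule n r s := by simp [voterSchedule]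
  have le : ∀ y y' h, (voteAuthoritiesRobust n t r s CV CA).law y adv (voterSchedule n r s) h ≤
      (voteAuthoritiesRobust n t r s CV CA).law y' adv (voterSchedule n r s) h := fun y y' h =>
    -- Without a tally nothing is required of the permutation, and the identity serves for arbitrary
    -- votes.
    robust_law_le ha₀ adv pairwise_not_reads_voterSchedule (π := 1) fun h => (htally h).elim
  rw [trunc, trunc]
  congr 1
  ext h
  exact le_antisymm (le _ _ _) (le _ _ _)

theorem robust_law_le_of_ideal_eq {a₀ : Fin t} (ha₀ : a₀ ∉ CA) {x x' : Fin n → Fin r}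
    (adv : RobustStrategy n t r s CV CA)
    (h : RobustTranscript n t r s CV CA) (hk : inputsOf CV x = inputsOf CV x')
    (ho : idealRobust x (revocation h) = idealRobust x' (revocation h)) :
    (voteAuthoritiesRobust n t r s CV CA).law x adv (robustSchedule n r s) h ≤
      (voteAuthoritiesRobust n t r s CV CA).law x' adv (robustSchedule n r s) h := by
  classical
  by_cases hR : CA.Nonempty ∨ revokedSet h ⊆ CV
  · rw [revocation, dif_pos hR] at ho
    obtain ⟨π, hπ, hx⟩ := exists_perm_of_card_eq (fun i => i ∉ CV ∧ ¬ Revoked h i) x x' fun c =>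
      card_honest_eq hk (fun i => ¬ Revoked h i) c
        (by simpa [idealRobust, revokedSet] using congrFun (congrArg Prod.snd ho) c)
    exact robust_law_le ha₀ adv pairwise_not_reads_robustSchedule fun _ => ⟨hπ, hx⟩
  · rw [not_or, Finset.not_nonempty_iff_eq_empty, Finset.not_subset] at hR
    obtain ⟨rfl, i, hi, hiCV⟩ := hR
    rw [revokedSet, Finset.mem_filter] at hi
    -- Such a transcript cannot occur, so any injection will do.
    refine Protocol.law_apply_le id Function.injective_id fun ρ hρ => ?_
    subst hρ
    exact (not_revoked_of_honest a₀.pos hiCV hi.2).elim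

theorem voteAuthoritiesRobust_perfectlyPrivate (hCA : ∃ a, a ∉ CA) :
    PerfectlyPrivate (voteAuthoritiesRobust n t r s CV CA) (inputsOf CV)
      (idealRobust (CV := CV) (CA := CA)) := by
  obtain ⟨a₀, ha₀⟩ := hCA
  exact Protocol.perfectlyPrivate_of_law _ revocation
    (fun adv _ _ _ => robust_map_revocation_eq ha₀ adv)
    fun adv _ _ h hk ho => le_antisymm (robust_law_le_of_ideal_eq ha₀ adv h hk ho)
      (robust_law_le_of_ideal_eq ha₀ adv h hk.symm ho.symm)

end

end Voting
end

/-- Perfect privacy of the three voting protocols against an arbitrary collusion. -/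
theorem theorem3 (n t r s : ℕ) [NeZero n] [NeZero r] [NeZero s] :
    (∀ C : Finset (Fin n), (∃ i, i ∉ C) →
      Voting.PerfectlyPrivate (Voting.voteBasic n r s C)
        (Voting.inputsOf C) Voting.idealTally) ∧
    (∀ (CV : Finset (Fin n)) (CA : Finset (Fin t)), (∃ a, a ∉ CA) →
      Voting.PerfectlyPrivate (Voting.voteAuthorities n t r s CV CA)
        (Voting.inputsOf CV) Voting.idealTally) ∧
    (∀ (CV : Finset (Fin n)) (CA : Finset (Fin t)), (∃ a, a ∉ CA) →
      Voting.PerfectlyPrivate (Voting.voteAuthoritiesRobust n t r s CV CA)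
        (Voting.inputsOf CV) (Voting.idealRobust (CV := CV) (CA := CA))) :=
  ⟨fun _ => Voting.voteBasic_perfectlyPrivate,
    fun _ _ => Voting.voteAuthorities_perfectlyPrivate,
    fun _ _ => Voting.voteAuthoritiesRobust_perfectlyPrivate⟩
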